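/- Let $n\ge 1$, let $G=GL(n,\mathbb{C})$, let $\mathcal{B}_n$ be the variety of full flags in $\mathbb{C}^n$, and let $e_1,\dots,e_n$ be the standard basis of $\mathbb{C}^n$. Write $(v_1\subset v_2\subset\dots\subset v_n)$ for the flag whose $i$-th subspace is $\mathrm{span}\{v_1,\dots,v_i\}$. Put $\mathcal{E}_+=(e_1\subset e_2\subset\dots\subset e_n)$ and $\mathcal{E}^*=(e_n\subset e_1\subset\dots\subset e_{n-1})$. Let $B\subset G$ be the subgroup of upper triangular matrices (the stabilizer of $\mathcal{E}_+$), let $B^*\subset G$ be the stabilizer of $\mathcal{E}^*$, and let $B_{n-1}$ be the group of upper triangular matrices of $GL(n-1,\mathbb{C})$, embedded in the upper left corner of $G$. The symmetric group $\mathcal{S}_n$ acts through permutation matrices, $w\cdot e_i=e_{w(i)}$. A pair $(w,y)\in\mathcal{S}_n\times\mathcal{S}_n$ is a \emph{Shareshian pair} if there is a $B_{n-1}$-orbit $Q$ on $\mathcal{B}_n$ such that $B\cdot Q=B\cdot w(\mathcal{E}_+)$ and $B^*\cdot Q=B^*\cdot y(\mathcal{E}^*)$ (equivalently, $B\cdot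 w(\mathcal{E}_+)\cap B^*\cdot y(\mathcal{E}^*)\ne\emptyset$). For a subset $\Delta=\{j_1<\dots<j_k<n\}$ of $\{1,\dots,n\}$ containing $n$ (with $k\ge 0$), let $\tau_\Delta\in\mathcal{S}_n$ be the $(k+1)$-cycle $(n,j_k,\dots,j_1)$, which sends $n\mapsto j_k\mapsto\dots\mapsto j_1\mapsto n$, and let $\sigma=(n,n-1,\dots,2,1)$. Call $\Delta$ \emph{decreasing for $w^{-1}$} if $w^{-1}(n)<w^{-1}(j_k)<\dots<w^{-1}(j_1)$; in this case $(w,\Delta)$ is called an \emph{$n$-decorated permutation}. Then a pair $(w,y)\in\mathcal{S}_n\times\mathcal{S}_n$ is a Shareshian pair if and only if there exists a subset $\Delta=\{j_1<\dots<j_k<n\}$ of $\{1,\dots,n\}$ containing $n$ such that (1) $y=\tau_\Delta w\sigma^{-1}$, and (2) $\Delta$ is decreasing for $w^{-1}$. Moreover, the map $(w,\Delta)\mapsto(w,\tau_\Delta w\sigma^{-1})$ is a bijection from the set of $n$-decorated permutations onto the set of Shareshian pairs. -/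

import Mathlib

open scoped Pointwise

/-- Full flags in `ℂⁿ`: maximal chains of subspaces of `ℂⁿ`. -/
abbrev FlagVariety (n : ℕ) : Type := Flag (Submodule ℂ (Fin n → ℂ))

/-- `GL(n, ℂ)` acts on flags by moving each subspace of the flag: `g • F = {g(V) : V ∈ F}`. -/
noncomputable instance flagAction (n : ℕ) :
    MulAction (GL (Fin n) ℂ) (FlagVariety n) where
  smul g F := Flag.map
    (Submodule.orderIsoMapComap
      (LinearMap.GeneralLinearGroup.toLinearEquiv (Matrix.GeneralLinearGroup.toLin g))) F
  one_smul F := by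
    apply SetLike.coe_injective
    ext p
    change p ∈ (fun q : Submodule ℂ (Fin n → ℂ) => q.map
      (Matrix.mulVecLin ((1 : GL (Fin n) ℂ) : Matrix (Fin n) (Fin n) ℂ))) '' (F : Set _) ↔ _
    simp
  mul_smul g g' F := by
    apply SetLike.coe_injective
    ext p
    change p ∈ (fun q : Submodule ℂ (Fin n → ℂ) => q.map
        (Matrix.mulVecLin ((g * g' : GL (Fin n) ℂ) : Matrix (Fin n) (Fin n) ℂ))) '' (F : Set _) ↔
      p ∈ (fun q : Submodule ℂ (Fin n → ℂ) => q.map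
          (Matrix.mulVecLin (g : Matrix (Fin n) (Fin n) ℂ))) ''
        ((fun q : Submodule ℂ (Fin n → ℂ) => q.map
          (Matrix.mulVecLin (g' : Matrix (Fin n) (Fin n) ℂ))) '' (F : Set _))
    rw [Set.image_image]
    simp [Matrix.mulVecLin_mul, Submodule.map_comp]

/-- A subspace lies in `g • F` iff it is the image under `v ↦ g v` of a subspace in `F`. -/
theorem mem_flag_smul {n : ℕ} (g : GL (Fin n) ℂ) (F : FlagVariety n)
    (p : Submodule ℂ (Fin n → ℂ)) :
    p ∈ g • F ↔ ∃ q ∈ F, q.map (Matrix.mulVecLin (g : Matrix (Fin n) (Fin n) ℂ)) = p :=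
  Iff.rfl

/-- The standard flag `(e₁ ⊂ e₂ ⊂ ⋯ ⊂ eₙ)`. -/
noncomputable def stdFlag (n : ℕ) : FlagVariety n :=
  (Pi.basisFun ℂ (Fin n)).toFlag

/-- The flag `(eₙ ⊂ e₁ ⊂ ⋯ ⊂ eₙ₋₁)`. -/
noncomputable def starFlag (n : ℕ) : FlagVariety n :=
  ((Pi.basisFun ℂ (Fin n)).reindex (finRotate n)).toFlag

/-- The subgroup `B` of invertible upper triangular matrices. -/
def upperBorel (n : ℕ) : Subgroup (GL (Fin n) ℂ) where
  carrier := {g | ∀ i j : Fin n, j < i → (g : Matrix (Fin n) (Fin n) ℂ) i j = 0}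
  one_mem' := by
    intro i j h
    simp [Matrix.one_apply_ne h.ne']
  mul_mem' := by
    intro a b ha hb i j h
    have ha' : (a : Matrix (Fin n) (Fin n) ℂ).BlockTriangular id := fun i j h => ha i j h
    have hb' : (b : Matrix (Fin n) (Fin n) ℂ).BlockTriangular id := fun i j h => hb i j h
    exact (ha'.mul hb') h
  inv_mem' := by
    intro a ha i j h
    have ha' : (a : Matrix (Fin n) (Fin n) ℂ).BlockTriangular id := fun i j h => ha i j h
    rw [Matrix.coe_units_inv]
    have : Invertible (a : Matrix (Fin n) (Fin n) ℂ) := a.invertible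
    exact (Matrix.blockTriangular_inv_of_blockTriangular ha') h

/-- The subgroup `B*`, the stabilizer of the flag `(eₙ ⊂ e₁ ⊂ ⋯ ⊂ eₙ₋₁)`. -/
noncomputable def starBorel (n : ℕ) : Subgroup (GL (Fin n) ℂ) :=
  MulAction.stabilizer (GL (Fin n) ℂ) (starFlag n)

/-- `GL(m)` embedded in the upper left corner of `GL(m+1)`: the invertible matrices whose last
column and last row are those of the identity matrix. -/
def cornerGL (m : ℕ) : Subgroup (GL (Fin (m + 1)) ℂ) where
  carrier := {g |
    (g : Matrix (Fin (m + 1)) (Fin (m + 1)) ℂ).mulVec (Pi.single (Fin.last m) 1) =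
      Pi.single (Fin.last m) 1 ∧
    Matrix.vecMul (Pi.single (Fin.last m) 1) (g : Matrix (Fin (m + 1)) (Fin (m + 1)) ℂ) =
      Pi.single (Fin.last m) 1}
  one_mem' := by
    constructor <;> simp only [Units.val_one, Matrix.one_mulVec, Matrix.vecMul_one]
  mul_mem' := by
    rintro a b ⟨ha, ha'⟩ ⟨hb, hb'⟩
    constructor
    · rw [Units.val_mul, ← Matrix.mulVec_mulVec, hb, ha]
    · rw [Units.val_mul, ← Matrix.vecMul_vecMul, ha', hb']
  inv_mem' := by
    rintro a ⟨ha, ha'⟩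
    constructor
    · nth_rewrite 1 [← ha]
      rw [Matrix.mulVec_mulVec, ← Units.val_mul, inv_mul_cancel, Units.val_one, Matrix.one_mulVec]
    · nth_rewrite 1 [← ha']
      rw [Matrix.vecMul_vecMul, ← Units.val_mul, mul_inv_cancel, Units.val_one, Matrix.vecMul_one]

/-- The subgroup `Bₘ` of upper triangular matrices of `GL(m)`, inside `GL(m+1)`. -/
def smallBorel (m : ℕ) : Subgroup (GL (Fin (m + 1)) ℂ) :=
  cornerGL m ⊓ upperBorel (m + 1)

/-- The permutation matrix of `w`, which sends the basis vector `e_i` to `e_{w(i)}`; it represents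
`w` in the normalizer of the diagonal torus. -/
noncomputable def permGL (n : ℕ) : Equiv.Perm (Fin n) →* GL (Fin n) ℂ :=
  MonoidHom.toHomUnits
    { toFun := fun w => Matrix.of fun i j => if i = w j then (1 : ℂ) else 0
      map_one' := by
        ext i j
        by_cases h : i = j <;> simp [Matrix.one_apply, h]
      map_mul' := by
        intro v w
        ext i j
        by_cases h : i = v (w j) <;> simp [Matrix.mul_apply, h] }

/-- `Sh(Q) = (w, y)` for a `Bₘ`-orbit `Q` of full flags in `ℂ^(m+1)`:
`B · Q = B · w(E₊)` and `B* · Q = B* · y(E*)`. -/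
def IsShareshianImage {m : ℕ}
    (Q : MulAction.orbitRel.Quotient (smallBorel m) (FlagVariety (m + 1)))
    (w y : Equiv.Perm (Fin (m + 1))) : Prop :=
  (upperBorel (m + 1) : Set (GL (Fin (m + 1)) ℂ)) • Q.orbit =
      MulAction.orbit (upperBorel (m + 1)) (permGL (m + 1) w • stdFlag (m + 1)) ∧
  (starBorel (m + 1) : Set (GL (Fin (m + 1)) ℂ)) • Q.orbit =
      MulAction.orbit (starBorel (m + 1)) (permGL (m + 1) y • starFlag (m + 1))

/-- `(w, y)` is a Shareshian pair: `(w, y) = Sh(Q)` for some `Bₘ`-orbit `Q`. -/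
def IsShareshianPair {m : ℕ} (w y : Equiv.Perm (Fin (m + 1))) : Prop :=
  ∃ Q : MulAction.orbitRel.Quotient (smallBorel m) (FlagVariety (m + 1)),
    IsShareshianImage Q w y

/-- For `Δ = {j₁ < ⋯ < jₖ < n}`, the cycle `(n, jₖ, …, j₁)`, sending each entry to the next one. -/
def tauCycle {n : ℕ} (Δ : Finset (Fin n)) : Equiv.Perm (Fin n) :=
  (Δ.sort (· ≥ ·)).formPerm

/-- The cycle `σ = (n, n-1, …, 2, 1)`, that is `i ↦ i - 1` and `1 ↦ n`. -/
def sigmaCycle (n : ℕ) : Equiv.Perm (Fin n) := (finRotate n)⁻¹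

/-- `(w, Δ)` is an `(m+1)`-decorated permutation: `Δ` contains the largest index, and `w⁻¹` is
strictly decreasing along `Δ`. -/
def IsDecorated {m : ℕ} (w : Equiv.Perm (Fin (m + 1))) (Δ : Finset (Fin (m + 1))) : Prop :=
  Fin.last m ∈ Δ ∧ StrictAntiOn (fun i => w⁻¹ i) (Δ : Set (Fin (m + 1)))

/-! Since `B_{n-1}` lies in `B ∩ B*`, only a flag common to both orbits matters, which amounts to an
equation `b w u = c v` with `v = yσ`, `b, u ∈ B`, `c ∈ B*`. Here `B*` is upper triangularity for the
star order `n, 1, …, n-1`. For `w i ≠ n`, column `w i` of `b` has star-leading row `w i`; it is also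
a combination of columns `v k` of `c`, `k ≤ i`, with nonzero coefficient at `k = i`. Comparing
leading rows constrains `π = v w⁻¹` (`le_and_exists_of_mul_eq`), and these constraints force `π =
τ_Δ` with `Δ` decreasing for `w⁻¹` (`exists_eq_tauCycle`). Conversely, explicit `b` and `u` are
written down for each decorated permutation. Injectivity holds because `Δ` is the support of `τ_Δ`
together with `n`. -/

/-! ### Combinatorics of the cycles `τ_Δ`. -/

theorem mem_sort_ge {n : ℕ} {Δ : Finset (Fin n)} {d : Fin n} : d ∈ Δ.sort (· ≥ ·) ↔ d ∈ Δ :=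
  Finset.mem_sort _

theorem tauCycle_apply_of_notMem {n : ℕ} {Δ : Finset (Fin n)} {d : Fin n} (hd : d ∉ Δ) :
    tauCycle Δ d = d :=
  List.formPerm_apply_of_notMem (mt mem_sort_ge.1 hd)

theorem tauCycle_apply_mem {n : ℕ} {Δ : Finset (Fin n)} {d : Fin n} (hd : d ∈ Δ) :
    tauCycle Δ d ∈ Δ :=
  mem_sort_ge.1 (List.formPerm_apply_mem_of_mem (mem_sort_ge.2 hd))

/-- On a non-minimal element `d` of `Δ`, the cycle takes the largest element of `Δ` below `d`. -/
theorem tauCycle_apply_of_lt {n : ℕ} {Δ : Finset (Fin n)} {d e : Fin n} (hd : d ∈ Δ) (he : e ∈ Δ)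
    (h : e < d) : tauCycle Δ d < d ∧ e ≤ tauCycle Δ d := by
  have hs : (Δ.sort (· ≥ ·)).Pairwise (· ≥ ·) := Δ.pairwise_sort _
  have hn : (Δ.sort (· ≥ ·)).Nodup := Δ.sort_nodup _
  obtain ⟨i, hi, rfl⟩ := List.getElem_of_mem (mem_sort_ge.2 hd)
  obtain ⟨j, hj, rfl⟩ := List.getElem_of_mem (mem_sort_ge.2 he)
  rw [List.pairwise_iff_getElem] at hs
  have hij : i < j := by
    rcases lt_trichotomy i j with h' | rfl | h'
    · exact h'
    · exact absurd h (lt_irrefl _)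
    · exact absurd h (hs j i hj hi h').not_gt
  have h1 : i + 1 < (Δ.sort (· ≥ ·)).length := by omega
  rw [tauCycle, List.formPerm_apply_lt_getElem _ hn i h1]
  refine ⟨lt_of_le_of_ne (hs i (i + 1) hi h1 (by omega)) fun h' => ?_, ?_⟩
  · have := hn.getElem_inj_iff.1 h'
    omega
  · rcases eq_or_lt_of_le (Nat.succ_le_of_lt hij) with h' | h'
    · subst h'
      exact le_rfl
    · exact hs (i + 1) j h1 hj h'

theorem tauCycle_apply_ne {n : ℕ} {Δ : Finset (Fin n)} {d e : Fin n} (hd : d ∈ Δ) (he : e ∈ Δ)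
    (h : d ≠ e) : tauCycle Δ d ≠ d := by
  rw [tauCycle, List.formPerm_apply_mem_ne_self_iff _ (Δ.sort_nodup _) _ (mem_sort_ge.2 hd),
    Finset.length_sort]
  exact Finset.one_lt_card.2 ⟨d, hd, e, he, h⟩

theorem tauCycle_injOn {n : ℕ} (a : Fin n) : Set.InjOn tauCycle {Δ : Finset (Fin n) | a ∈ Δ} := by
  have key : ∀ Δ Δ' : Finset (Fin n), a ∈ Δ → a ∈ Δ' → tauCycle Δ = tauCycle Δ' → Δ ⊆ Δ' := by
    intro Δ Δ' h h' e d hd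
    by_cases hda : d = a
    · exact hda ▸ h'
    · by_contra hd'
      exact tauCycle_apply_ne hd h hda (by rw [e, tauCycle_apply_of_notMem hd'])
  exact fun Δ h Δ' h' e => (key _ _ h h' e).antisymm (key _ _ h' h e.symm)

theorem Equiv.Perm.eq_of_eqOn_compl_singleton {α : Type*} {f g : Equiv.Perm α} (a : α)
    (h : ∀ x, x ≠ a → f x = g x) : f = g := by
  ext x
  by_cases hx : x = a
  · subst hx
    by_contra hne
    have h1 : f.symm (g x) ≠ x := fun h' => hne (f.symm_apply_eq.1 h').symm
    have h2 := h _ h1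
    rw [Equiv.apply_symm_apply] at h2
    exact h1 (g.injective h2.symm)
  · exact h x hx

/-- A permutation `π` that lowers points other than `n`, except when it returns to `n`, and along
which `q` increases, is a cycle `τ_Δ` with `q` decreasing on `Δ`. -/
theorem exists_eq_tauCycle {m : ℕ} (π q : Equiv.Perm (Fin (m + 1)))
    (h1 : ∀ d, d ≠ Fin.last m → π d = Fin.last m ∨ π d ≤ d)
    (h2 : ∀ d, d ≠ Fin.last m → q (π⁻¹ d) ≤ q d) :
    ∃ Δ : Finset (Fin (m + 1)), Fin.last m ∈ Δ ∧ π = tauCycle Δ ∧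
      StrictAntiOn q (Δ : Set (Fin (m + 1))) := by
  classical
  -- The insertion matters only when `π` fixes `n`.
  set Δ : Finset (Fin (m + 1)) := insert (Fin.last m) π.support with hΔ
  have hmem : ∀ d, d ∈ Δ ↔ d = Fin.last m ∨ π d ≠ d := by simp [hΔ]
  have step : ∀ d, d ∈ Δ → π d ≠ Fin.last m → π d ∈ Δ ∧ π d < d ∧ q d < q (π d) := by
    intro d hd hne
    have hfix : π d ≠ d := by
      rcases (hmem d).1 hd with rfl | h
      · exact hne
      · exact h
    refine ⟨(hmem _).2 (Or.inr fun h => hfix (π.injective h)), lt_of_le_of_ne ?_ hfix, ?_⟩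
    · by_cases hdl : d = Fin.last m
      · exact hdl ▸ Fin.le_last _
      · exact (h1 d hdl).resolve_left hne
    · have := h2 _ hne
      rw [Equiv.Perm.inv_def, Equiv.symm_apply_apply] at this
      exact lt_of_le_of_ne this fun h => hfix (q.injective h).symm
  -- No element of `Δ` is skipped, so `π` has a single nontrivial cycle at most. Downward induction
  -- on `e`, comparing `π⁻¹ e > e` with `d`; if `π⁻¹ e > d`, the claim for the pair `d < π⁻¹ e`
  -- gives `d ≤ e`.
  have next : ∀ e ∈ Δ, ∀ d ∈ Δ, e < d → π d ≠ Fin.last m ∧ e ≤ π d := by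
    intro e
    induction e using WellFoundedGT.induction with
    | _ e ih =>
    intro he d hd hed
    have hel : e ≠ Fin.last m := (hed.trans_le (Fin.le_last d)).ne
    have hπ : π (π⁻¹ e) = e := π.apply_symm_apply e
    have he' : π⁻¹ e ∈ Δ := (hmem _).2 <| Or.inr <| by
      rw [hπ]
      intro h
      rw [← h] at hπ
      exact ((hmem e).1 he).elim hel fun h' => h' hπ
    have hlt : e < π⁻¹ e := by
      have := (step _ he' (by rwa [hπ])).2.1
      rwa [hπ] at this
    rcases lt_trichotomy (π⁻¹ e) d with h | h | h
    · exact ⟨(ih _ hlt he' d hd h).1, hlt.le.trans (ih _ hlt he' d hd h).2⟩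
    · rw [← h, hπ]
      exact ⟨hel, le_rfl⟩
    · have := (ih d hed hd _ he' h).2
      rw [hπ] at this
      exact absurd hed this.not_gt
  have hlast : Fin.last m ∈ Δ := (hmem _).2 (Or.inl rfl)
  refine ⟨Δ, hlast, ?_, ?_⟩
  -- Off the minimum, both permutations send `d ∈ Δ` to its predecessor in `Δ`; the value at the
  -- minimum is then forced.
  · refine Equiv.Perm.eq_of_eqOn_compl_singleton (Δ.min' ⟨_, hlast⟩) fun d hd => ?_
    by_cases hdΔ : d ∈ Δ
    · have hlt := lt_of_le_of_ne (Δ.min'_le d hdΔ) (Ne.symm hd)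
      have hmin := Δ.min'_mem ⟨_, hlast⟩
      have hstep := step d hdΔ (next _ hmin d hdΔ hlt).1
      have hτ := tauCycle_apply_of_lt hdΔ hmin hlt
      exact le_antisymm (tauCycle_apply_of_lt hdΔ hstep.1 hstep.2.1).2
        (next _ (tauCycle_apply_mem hdΔ) d hdΔ hτ.1).2
    · rw [tauCycle_apply_of_notMem hdΔ]
      by_contra h
      exact hdΔ ((hmem d).2 (Or.inr h))
  · intro e he d
    induction d using WellFoundedLT.induction with
    | _ d ih =>
    intro hd hed
    obtain ⟨hne, hle⟩ := next e he d hd hed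
    obtain ⟨hm, hlt, hq⟩ := step d hd hne
    rcases hle.eq_or_lt with h | h
    · exact h ▸ hq
    · exact hq.trans (ih _ hlt hm h)
-- Matrix descriptions of `B`, `B*` and the two base flags.
theorem mem_upperBorel {n : ℕ} {g : GL (Fin n) ℂ} :
    g ∈ upperBorel n ↔ ∀ i j : Fin n, j < i → (g : Matrix (Fin n) (Fin n) ℂ) i j = 0 :=
  Iff.rfl

theorem permGL_coe_apply {n : ℕ} (w : Equiv.Perm (Fin n)) (i j : Fin n) :
    (permGL n w : Matrix (Fin n) (Fin n) ℂ) i j = if i = w j then 1 else 0 :=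
  rfl

theorem mul_permGL_apply {n : ℕ} (g : GL (Fin n) ℂ) (w : Equiv.Perm (Fin n)) (i j : Fin n) :
    ((g * permGL n w : GL (Fin n) ℂ) : Matrix (Fin n) (Fin n) ℂ) i j =
      (g : Matrix (Fin n) (Fin n) ℂ) i (w j) := by
  simp [Matrix.mul_apply, permGL_coe_apply]

theorem permGL_mul_apply {n : ℕ} (g : GL (Fin n) ℂ) (w : Equiv.Perm (Fin n)) (i j : Fin n) :
    ((permGL n w * g : GL (Fin n) ℂ) : Matrix (Fin n) (Fin n) ℂ) i j =
      (g : Matrix (Fin n) (Fin n) ℂ) (w⁻¹ i) j := by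
  have (k : Fin n) : i = w k ↔ k = w⁻¹ i := by rw [Equiv.Perm.eq_inv_iff_eq, eq_comm]
  simp [Matrix.mul_apply, permGL_coe_apply, this]

theorem diag_ne_zero_of_mem_upperBorel {n : ℕ} {g : GL (Fin n) ℂ} (hg : g ∈ upperBorel n)
    (i : Fin n) : (g : Matrix (Fin n) (Fin n) ℂ) i i ≠ 0 := by
  have hdet : (g : Matrix (Fin n) (Fin n) ℂ).det = ∏ i, (g : Matrix (Fin n) (Fin n) ℂ) i i :=
    Matrix.det_of_isUpperTriangular fun i j h => hg i j h
  have hne : (g : Matrix (Fin n) (Fin n) ℂ).det ≠ 0 :=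
    ((Matrix.isUnit_iff_isUnit_det _).1 g.isUnit).ne_zero
  rw [hdet, Finset.prod_ne_zero_iff] at hne
  exact hne i (Finset.mem_univ i)

/-- Upper triangular matrices with nonzero diagonal entries are invertible. -/
theorem exists_coe_eq_mem_upperBorel {n : ℕ} (A : Matrix (Fin n) (Fin n) ℂ)
    (h : ∀ i j, j < i → A i j = 0) (hd : ∀ i, A i i ≠ 0) :
    ∃ g ∈ upperBorel n, (g : Matrix (Fin n) (Fin n) ℂ) = A := by
  have hdet : A.det ≠ 0 := by
    rw [Matrix.det_of_isUpperTriangular fun i j h' => h i j h', Finset.prod_ne_zero_iff]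
    exact fun i _ => hd i
  exact ⟨Matrix.GeneralLinearGroup.mkOfDetNeZero A hdet, h, rfl⟩

theorem mulVecLin_single {n : ℕ} (A : Matrix (Fin n) (Fin n) ℂ) (j i : Fin n) :
    A.mulVecLin (Pi.single j 1) i = A i j := by
  simp

theorem mem_stdFlag_flag_iff {n : ℕ} {x : Fin n → ℂ} {k : Fin (n + 1)} :
    x ∈ (Pi.basisFun ℂ (Fin n)).flag k ↔ ∀ i : Fin n, k ≤ i.castSucc → x i = 0 := by
  rw [Module.Basis.flag, Module.Basis.mem_span_image]
  simp only [Set.subset_def, SetLike.mem_coe, Finsupp.mem_support_iff, Pi.basisFun_repr,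
    Set.mem_ofPred_eq]
  exact forall_congr' fun i => by rw [← not_lt]; tauto

theorem map_flag_le_of_mem_upperBorel {n : ℕ} {g : GL (Fin n) ℂ} (hg : g ∈ upperBorel n)
    (k : Fin (n + 1)) :
    ((Pi.basisFun ℂ (Fin n)).flag k).map (Matrix.mulVecLin (g : Matrix (Fin n) (Fin n) ℂ)) ≤
      (Pi.basisFun ℂ (Fin n)).flag k := by
  rw [Submodule.map_le_iff_le_comap, Module.Basis.flag_le_iff]
  intro j hj
  rw [Submodule.mem_comap, mem_stdFlag_flag_iff]
  intro i hi
  rw [Pi.basisFun_apply, mulVecLin_single]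
  exact hg i j (Fin.castSucc_lt_castSucc_iff.1 (hj.trans_le hi))

theorem finrank_map_mulVecLin {n : ℕ} (g : GL (Fin n) ℂ) (p : Submodule ℂ (Fin n → ℂ)) :
    Module.finrank ℂ (p.map (Matrix.mulVecLin (g : Matrix (Fin n) (Fin n) ℂ))) =
      Module.finrank ℂ p :=
  (LinearMap.GeneralLinearGroup.toLinearEquiv (Matrix.GeneralLinearGroup.toLin g)).finrank_map_eq p

theorem smul_stdFlag_eq_iff {n : ℕ} {g : GL (Fin n) ℂ} :
    g • stdFlag n = stdFlag n ↔ g ∈ upperBorel n := by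
  constructor
  · intro h i j hij
    have hmem : ((Pi.basisFun ℂ (Fin n)).flag j.succ).map
        (Matrix.mulVecLin (g : Matrix (Fin n) (Fin n) ℂ)) ∈ stdFlag n := by
      rw [← h]
      exact (mem_flag_smul _ _ _).2 ⟨_, ⟨_, rfl⟩, rfl⟩
    have hmem' : (Pi.basisFun ℂ (Fin n)).flag j.succ ∈ stdFlag n := ⟨_, rfl⟩
    have heq : ((Pi.basisFun ℂ (Fin n)).flag j.succ).map
        (Matrix.mulVecLin (g : Matrix (Fin n) (Fin n) ℂ)) =
          (Pi.basisFun ℂ (Fin n)).flag j.succ := by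
      rcases (stdFlag n).le_or_le hmem hmem' with hle | hle
      · exact Submodule.eq_of_le_of_finrank_eq hle (finrank_map_mulVecLin g _)
      · exact (Submodule.eq_of_le_of_finrank_eq hle (finrank_map_mulVecLin g _).symm).symm
    have hx : Matrix.mulVecLin (g : Matrix (Fin n) (Fin n) ℂ) (Pi.single j 1) ∈
        (Pi.basisFun ℂ (Fin n)).flag j.succ := by
      rw [← heq, ← Pi.basisFun_apply]
      exact Submodule.mem_map_of_mem (Module.Basis.self_mem_flag _ Fin.castSucc_lt_succ)
    have := mem_stdFlag_flag_iff.1 hx i (Fin.succ_le_castSucc_iff.2 hij)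
    rwa [mulVecLin_single] at this
  · intro hg
    refine Flag.ext (Set.Subset.antisymm ?_ ?_)
    · rintro p hp
      obtain ⟨_, ⟨k, rfl⟩, rfl⟩ := (mem_flag_smul _ _ _).1 hp
      exact ⟨k, (Submodule.eq_of_le_of_finrank_eq (map_flag_le_of_mem_upperBorel hg k)
        (finrank_map_mulVecLin g _)).symm⟩
    · rintro _ ⟨k, rfl⟩
      exact (mem_flag_smul _ _ _).2 ⟨_, ⟨k, rfl⟩,
        Submodule.eq_of_le_of_finrank_eq (map_flag_le_of_mem_upperBorel hg k)
        (finrank_map_mulVecLin g _)⟩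

theorem starFlag_eq_smul (n : ℕ) : starFlag n = permGL n (sigmaCycle n) • stdFlag n := by
  have key (k : Fin (n + 1)) : ((Pi.basisFun ℂ (Fin n)).flag k).map
      (Matrix.mulVecLin (permGL n (sigmaCycle n) : Matrix (Fin n) (Fin n) ℂ)) =
        ((Pi.basisFun ℂ (Fin n)).reindex (finRotate n)).flag k := by
    rw [Module.Basis.flag, Module.Basis.flag, Submodule.map_span, ← Set.image_comp]
    congr 1
    refine Set.image_congr fun j _ => ?_
    ext i
    rw [Function.comp_apply, Pi.basisFun_apply, mulVecLin_single, permGL_coe_apply,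
      Module.Basis.reindex_apply, Pi.basisFun_apply, Pi.single_apply]
    rfl
  apply Flag.ext
  ext p
  constructor
  · rintro ⟨k, rfl⟩
    exact (mem_flag_smul _ _ _).2 ⟨_, ⟨k, rfl⟩, key k⟩
  · intro hp
    obtain ⟨_, ⟨k, rfl⟩, rfl⟩ := (mem_flag_smul _ _ _).1 hp
    exact ⟨k, (key k).symm⟩

theorem mem_starBorel_iff_conj {n : ℕ} {g : GL (Fin n) ℂ} :
    g ∈ starBorel n ↔ (permGL n (sigmaCycle n))⁻¹ * g * permGL n (sigmaCycle n) ∈ upperBorel n := by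
  rw [starBorel, MulAction.mem_stabilizer_iff, starFlag_eq_smul, ← smul_stdFlag_eq_iff, mul_smul,
    mul_smul, inv_smul_eq_iff]

theorem conj_sigmaCycle_apply {n : ℕ} (g : GL (Fin n) ℂ) (i j : Fin n) :
    (((permGL n (sigmaCycle n))⁻¹ * g * permGL n (sigmaCycle n) : GL (Fin n) ℂ) :
      Matrix (Fin n) (Fin n) ℂ) (finRotate n i) (finRotate n j) =
        (g : Matrix (Fin n) (Fin n) ℂ) i j := by
  rw [mul_permGL_apply, ← map_inv, permGL_mul_apply, inv_inv, sigmaCycle,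
    Equiv.Perm.inv_def, Equiv.symm_apply_apply, Equiv.symm_apply_apply]

/-- Conjugation by `σ` turns `B*` into `B`. Comparing indices through `finRotate` is the star order,
in which the last index comes first. -/
theorem mem_starBorel_iff {n : ℕ} {g : GL (Fin n) ℂ} :
    g ∈ starBorel n ↔ ∀ i j : Fin n, finRotate n j < finRotate n i →
      (g : Matrix (Fin n) (Fin n) ℂ) i j = 0 := by
  rw [mem_starBorel_iff_conj, mem_upperBorel]
  refine ⟨fun h i j hij => ?_, fun h i j hij => ?_⟩
  · rw [← conj_sigmaCycle_apply, h _ _ hij]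
  · obtain ⟨i, rfl⟩ := (finRotate n).surjective i
    obtain ⟨j, rfl⟩ := (finRotate n).surjective j
    rw [conj_sigmaCycle_apply, h i j hij]

theorem diag_ne_zero_of_mem_starBorel {n : ℕ} {g : GL (Fin n) ℂ} (hg : g ∈ starBorel n)
    (i : Fin n) : (g : Matrix (Fin n) (Fin n) ℂ) i i ≠ 0 := by
  rw [← conj_sigmaCycle_apply]
  exact diag_ne_zero_of_mem_upperBorel (mem_starBorel_iff_conj.1 hg) _

theorem finRotate_lt_finRotate_iff {m : ℕ} {i j : Fin (m + 1)} :
    finRotate (m + 1) i < finRotate (m + 1) j ↔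
      j ≠ Fin.last m ∧ (i = Fin.last m ∨ i < j) := by
  cases i using Fin.lastCases <;> cases j using Fin.lastCases <;>
    simp [Fin.succ_pos, Fin.castSucc_lt_last]

theorem smallBorel_le_starBorel (m : ℕ) : smallBorel m ≤ starBorel (m + 1) := by
  rintro g ⟨⟨hg, -⟩, hB⟩
  refine mem_starBorel_iff.2 fun i j hij => ?_
  obtain ⟨hi, rfl | h⟩ := finRotate_lt_finRotate_iff.1 hij
  · have := congrFun hg i
    simpa [hi] using this
  · exact hB i j h

/-! ### From orbits to a matrix equation. -/

theorem smul_orbit_eq_orbit_of_le {G X : Type*} [Group G] [MulAction G X] {H K : Subgroup G}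
    (h : H ≤ K) (x : X) : (K : Set G) • MulAction.orbit H x = MulAction.orbit K x := by
  ext y
  constructor
  · rintro ⟨k, hk, _, ⟨g, rfl⟩, rfl⟩
    exact ⟨⟨k * g, K.mul_mem hk (h g.2)⟩, mul_smul _ _ _⟩
  · rintro ⟨k, rfl⟩
    exact ⟨k, k.2, x, MulAction.mem_orbit_self x, rfl⟩

theorem isShareshianPair_iff_exists_flag {m : ℕ} {w y : Equiv.Perm (Fin (m + 1))} :
    IsShareshianPair w y ↔ ∃ F : FlagVariety (m + 1),
      F ∈ MulAction.orbit (upperBorel (m + 1)) (permGL (m + 1) w • stdFlag (m + 1)) ∧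
      F ∈ MulAction.orbit (starBorel (m + 1)) (permGL (m + 1) y • starFlag (m + 1)) := by
  have key (F : FlagVariety (m + 1)) :
      IsShareshianImage (Quotient.mk'' F : MulAction.orbitRel.Quotient (smallBorel m) _) w y ↔
      F ∈ MulAction.orbit (upperBorel (m + 1)) (permGL (m + 1) w • stdFlag (m + 1)) ∧
      F ∈ MulAction.orbit (starBorel (m + 1)) (permGL (m + 1) y • starFlag (m + 1)) := by
    rw [IsShareshianImage, MulAction.orbitRel.Quotient.orbit_mk,
      smul_orbit_eq_orbit_of_le (H := smallBorel m) inf_le_right,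
      smul_orbit_eq_orbit_of_le (smallBorel_le_starBorel m),
      MulAction.orbit_eq_iff, MulAction.orbit_eq_iff]
  constructor
  · rintro ⟨Q, hQ⟩
    induction Q using Quotient.inductionOn' with
    | _ F => exact ⟨F, (key F).1 hQ⟩
  · rintro ⟨F, hF⟩
    exact ⟨_, (key F).2 hF⟩

theorem isShareshianPair_iff_exists_matrix {m : ℕ} {w y : Equiv.Perm (Fin (m + 1))} :
    IsShareshianPair w y ↔ ∃ b ∈ upperBorel (m + 1), ∃ u ∈ upperBorel (m + 1),
      ∃ c ∈ starBorel (m + 1),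
        b * permGL (m + 1) w * u = c * permGL (m + 1) (y * sigmaCycle (m + 1)) := by
  rw [isShareshianPair_iff_exists_flag]
  constructor
  · rintro ⟨_, ⟨⟨b, hb⟩, rfl⟩, ⟨⟨c, hc⟩, h⟩⟩
    -- `b w` and `c y σ` carry the standard flag to the same flag, so their quotient stabilizes it.
    refine ⟨b, hb, (b * permGL (m + 1) w)⁻¹ * (c * permGL (m + 1) (y * sigmaCycle (m + 1))), ?_,
      c, hc, by group⟩
    rw [← smul_stdFlag_eq_iff, mul_smul, inv_smul_eq_iff, map_mul, mul_smul, mul_smul, mul_smul,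
      ← starFlag_eq_smul]
    exact h
  · rintro ⟨b, hb, u, hu, c, hc, h⟩
    refine ⟨b • permGL (m + 1) w • stdFlag (m + 1), ⟨⟨b, hb⟩, rfl⟩, ⟨⟨c, hc⟩, ?_⟩⟩
    change c • permGL (m + 1) y • starFlag (m + 1) = _
    rw [starFlag_eq_smul, ← mul_smul (permGL _ y), ← map_mul, ← mul_smul, ← h, mul_smul, mul_smul,
      smul_stdFlag_eq_iff.2 hu]
-- Necessity: comparing leading entries.
/-- Comparison of the leading entries of the columns of `b w = c v u⁻¹`. -/
theorem le_and_exists_of_mul_eq {m : ℕ} {w v : Equiv.Perm (Fin (m + 1))}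
    {b u c : GL (Fin (m + 1)) ℂ} (hb : b ∈ upperBorel (m + 1)) (hu : u ∈ upperBorel (m + 1))
    (hc : c ∈ starBorel (m + 1)) (h : b * permGL (m + 1) w * u = c * permGL (m + 1) v)
    {i : Fin (m + 1)} (hi : w i ≠ Fin.last m) :
    finRotate (m + 1) (v i) ≤ finRotate (m + 1) (w i) ∧ ∃ k ≤ i, v k = w i := by
  classical
  have hU : u⁻¹ ∈ upperBorel (m + 1) := inv_mem hu
  set U : Matrix (Fin (m + 1)) (Fin (m + 1)) ℂ := Units.val u⁻¹
  have hE (a : Fin (m + 1)) : (b : Matrix (Fin (m + 1)) (Fin (m + 1)) ℂ) a (w i) =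
      ∑ k, (c : Matrix (Fin (m + 1)) (Fin (m + 1)) ℂ) a (v k) * U k i := by
    rw [← mul_permGL_apply, eq_mul_inv_of_mul_eq h, Units.val_mul, Matrix.mul_apply]
    exact Finset.sum_congr rfl fun k _ => by rw [mul_permGL_apply]
  have hii : U i i ≠ 0 := diag_ne_zero_of_mem_upperBorel hU i
  -- Among the columns of `c` that occur, the star-largest index `v k` gives a leading entry that
  -- cannot cancel.
  obtain ⟨k, hk, hmax⟩ := Finset.exists_max_image (Finset.univ.filter fun k => U k i ≠ 0)
    (fun k => finRotate (m + 1) (v k)) ⟨i, by simpa using hii⟩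
  simp only [Finset.mem_filter, Finset.mem_univ, true_and] at hk hmax
  have hki : k ≤ i := not_lt.1 fun h' => hk (hU k i h')
  have hne : (b : Matrix (Fin (m + 1)) (Fin (m + 1)) ℂ) (v k) (w i) ≠ 0 := by
    rw [hE, Finset.sum_eq_single k]
    · exact mul_ne_zero (diag_ne_zero_of_mem_starBorel hc _) hk
    · intro l _ hl
      by_cases hl0 : U l i = 0
      · rw [hl0, mul_zero]
      · rw [mem_starBorel_iff.1 hc, zero_mul]
        exact lt_of_le_of_ne (hmax l hl0) fun h' =>
          hl (v.injective ((finRotate (m + 1)).injective h'))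
    · exact fun h' => absurd (Finset.mem_univ k) h'
  have hle : v k ≤ w i := not_lt.1 fun h' => hne (hb _ _ h')
  -- Otherwise row `w i` lies strictly beyond `v k` in the star order (here `w i ≠ n` is needed),
  -- making the diagonal entry of `b` there zero.
  have heq : v k = w i := by
    by_contra hvw
    refine diag_ne_zero_of_mem_upperBorel hb (w i) ?_
    rw [hE]
    refine Finset.sum_eq_zero fun l _ => ?_
    by_cases hl0 : U l i = 0
    · rw [hl0, mul_zero]
    · rw [mem_starBorel_iff.1 hc, zero_mul]
      exact (hmax l hl0).trans_lt
        (finRotate_lt_finRotate_iff.2 ⟨hi, Or.inr (lt_of_le_of_ne hle hvw)⟩)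
  exact ⟨heq ▸ hmax i hii, k, hki, heq⟩

theorem exists_tauCycle_of_isShareshianPair {m : ℕ} {w y : Equiv.Perm (Fin (m + 1))}
    (h : IsShareshianPair w y) :
    ∃ Δ : Finset (Fin (m + 1)), Fin.last m ∈ Δ ∧
      y = tauCycle Δ * w * (sigmaCycle (m + 1))⁻¹ ∧
      StrictAntiOn (fun i => w⁻¹ i) (Δ : Set (Fin (m + 1))) := by
  obtain ⟨b, hb, u, hu, c, hc, h⟩ := isShareshianPair_iff_exists_matrix.1 h
  set v := y * sigmaCycle (m + 1) with hv
  have h1 (d : Fin (m + 1)) (hd : d ≠ Fin.last m) :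
      (v * w⁻¹) d = Fin.last m ∨ (v * w⁻¹) d ≤ d := by
    obtain ⟨i, rfl⟩ := w.surjective d
    have hle := (le_and_exists_of_mul_eq hb hu hc h hd).1
    rw [Equiv.Perm.mul_apply, Equiv.Perm.inv_def, Equiv.symm_apply_apply]
    rcases hle.eq_or_lt with h' | h'
    · exact Or.inr ((finRotate (m + 1)).injective h').le
    · exact (finRotate_lt_finRotate_iff.1 h').2.imp_right le_of_lt
  have h2 (d : Fin (m + 1)) (hd : d ≠ Fin.last m) : w⁻¹ ((v * w⁻¹)⁻¹ d) ≤ w⁻¹ d := by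
    obtain ⟨i, rfl⟩ := w.surjective d
    obtain ⟨k, hki, hk⟩ := (le_and_exists_of_mul_eq hb hu hc h hd).2
    rw [mul_inv_rev, inv_inv, Equiv.Perm.mul_apply, Equiv.Perm.inv_def, Equiv.Perm.inv_def,
      Equiv.symm_apply_apply, Equiv.symm_apply_apply, ← hk, Equiv.symm_apply_apply]
    exact hki
  obtain ⟨Δ, hΔ, hτ, hanti⟩ := exists_eq_tauCycle (v * w⁻¹) w⁻¹ h1 h2
  refine ⟨Δ, hΔ, ?_, hanti⟩
  rw [← hτ, hv]
  group

/-! ### Sufficiency: explicit matrices. -/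

theorem isShareshianPair_of_isDecorated {m : ℕ} {w : Equiv.Perm (Fin (m + 1))}
    {Δ : Finset (Fin (m + 1))} (h : IsDecorated w Δ) :
    IsShareshianPair w (tauCycle Δ * w * (sigmaCycle (m + 1))⁻¹) := by
  classical
  obtain ⟨hlast, hanti⟩ := h
  rw [isShareshianPair_iff_exists_matrix, inv_mul_cancel_right]
  -- `b` sends `e_n` to the sum of all `e_a` with `a ∈ Δ`, and fixes the other basis vectors.
  obtain ⟨b, hb, hbA⟩ := exists_coe_eq_mem_upperBorel
    (1 + Matrix.of fun a d => if d = Fin.last m ∧ a ∈ Δ ∧ a ≠ Fin.last m then (1 : ℂ) else 0)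
    (fun i j hij => by
      have : ¬ (j = Fin.last m) := (hij.trans_le (Fin.le_last i)).ne
      simp [Matrix.one_apply_ne hij.ne', this])
    (fun i => by
      have : ¬ (i = Fin.last m ∧ i ∈ Δ ∧ i ≠ Fin.last m) := fun h => h.2.2 h.1
      rw [Matrix.add_apply, Matrix.one_apply_eq, Matrix.of_apply, if_neg this, add_zero]
      exact one_ne_zero)
  -- For `x ∈ Δ`, `x ≠ n`, column `x` of `b R` is `e_n + ∑ e_a` over `a ∈ Δ`, `a < x`: the terms
  -- with `x ≤ a < n` cancel. Its star-leading row is `τ_Δ x`, also when `x` is minimal, where only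
  -- `e_n` remains.
  set R : Matrix (Fin (m + 1)) (Fin (m + 1)) ℂ := Matrix.of fun a x =>
    if x ∉ Δ ∨ x = Fin.last m then if a = x then 1 else 0
    else if a = Fin.last m then 1 else if a ∈ Δ ∧ x ≤ a then -1 else 0 with hR
  obtain ⟨u, hu, huA⟩ := exists_coe_eq_mem_upperBorel (Matrix.of fun i j => R (w i) (w j))
    (fun i j hij => by
      have hne : w i ≠ w j := fun h' => hij.ne' (w.injective h')
      -- Decreasingness of `w⁻¹` on `Δ` is what makes `w⁻¹ R w` upper triangular.
      have hle (hi : w i ∈ Δ) (hj : w j ∈ Δ) : w i < w j := by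
        by_contra h'
        have := hanti hj hi (lt_of_le_of_ne (not_lt.1 h') hne.symm)
        simp only [Equiv.Perm.inv_def, Equiv.symm_apply_apply] at this
        exact this.not_gt hij
      simp only [hR, Matrix.of_apply]
      by_cases hj : w j ∉ Δ ∨ w j = Fin.last m
      · rw [if_pos hj, if_neg hne]
      · rw [not_or, not_not] at hj
        rw [if_neg (by tauto), if_neg, if_neg]
        · exact fun hi => (hle hi.1 hj.1).not_ge hi.2
        · intro hi
          exact (hle (hi ▸ hlast) hj.1).not_ge (hi ▸ Fin.le_last _))
    (fun i => by
      simp only [hR, Matrix.of_apply]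
      split_ifs <;> simp_all)
  refine ⟨b, hb, u, hu, b * permGL (m + 1) w * u * (permGL (m + 1) (tauCycle Δ * w))⁻¹,
    mem_starBorel_iff.2 fun a e hlt => ?_, by group⟩
  obtain ⟨j, rfl⟩ := (tauCycle Δ * w).surjective e
  rw [← mul_permGL_apply, inv_mul_cancel_right, Units.val_mul, Matrix.mul_apply]
  simp only [mul_permGL_apply, huA, Matrix.of_apply]
  rw [Equiv.sum_comp w fun d => (b : Matrix (Fin (m + 1)) (Fin (m + 1)) ℂ) a d * R d (w j),
    ← Matrix.mul_apply, hbA, add_mul, one_mul, Matrix.add_apply, Matrix.mul_apply]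
  rw [Equiv.Perm.mul_apply] at hlt
  generalize w j = x at hlt ⊢
  obtain ⟨ha, hx⟩ := finRotate_lt_finRotate_iff.1 hlt
  have hsum : ∑ d, (Matrix.of fun a d =>
      if d = Fin.last m ∧ a ∈ Δ ∧ a ≠ Fin.last m then (1 : ℂ) else 0) a d * R d x =
        if a ∈ Δ then R (Fin.last m) x else 0 := by
    rw [Finset.sum_eq_single (Fin.last m)]
    · simp [ha]
    · intro d _ hd
      simp [hd]
    · simp
  -- `τ_Δ x` is the predecessor of `x` in `Δ`, so no `a ∈ Δ` below `x` can be star-beyond it.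
  have hnot (hax : a < x) (haΔ : a ∈ Δ) (hxΔ : x ∈ Δ) : False := by
    obtain ⟨h1, h2⟩ := tauCycle_apply_of_lt hxΔ haΔ hax
    rcases hx with hx | hx
    · exact h1.not_ge (hx ▸ Fin.le_last x)
    · exact hx.not_ge h2
  rw [hsum]
  simp only [hR, Matrix.of_apply]
  by_cases hxΔ : x ∈ Δ
  · by_cases hxl : x = Fin.last m
    · subst hxl
      have haΔ : a ∉ Δ := fun haΔ => hnot (Fin.lt_last_iff_ne_last.2 ha) haΔ hxΔ
      simp [ha, haΔ]
    · by_cases haΔ : a ∈ Δ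
      · have : x ≤ a := not_lt.1 fun h' => hnot h' haΔ hxΔ
        simp [hxΔ, hxl, ha, haΔ, this]
      · simp [hxΔ, hxl, ha, haΔ]
  · rw [tauCycle_apply_of_notMem hxΔ] at hx
    have hxl : Fin.last m ≠ x := fun h' => hxΔ (h' ▸ hlast)
    have hax : a ≠ x := by
      rintro rfl
      rcases hx with hx | hx
      · exact ha hx
      · exact lt_irrefl _ hx
    simp [hxΔ, hxl, hax]

theorem propositionp (m : ℕ) :
    (∀ w y : Equiv.Perm (Fin (m + 1)),
      IsShareshianPair w y ↔
        ∃ Δ : Finset (Fin (m + 1)), Fin.last m ∈ Δ ∧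
          y = tauCycle Δ * w * (sigmaCycle (m + 1))⁻¹ ∧
          StrictAntiOn (fun i => w⁻¹ i) (Δ : Set (Fin (m + 1)))) ∧
    Set.BijOn
      (fun p : Equiv.Perm (Fin (m + 1)) × Finset (Fin (m + 1)) =>
        (p.1, tauCycle p.2 * p.1 * (sigmaCycle (m + 1))⁻¹))
      {p | IsDecorated p.1 p.2}
      {p : Equiv.Perm (Fin (m + 1)) × Equiv.Perm (Fin (m + 1)) | IsShareshianPair p.1 p.2} := by
  refine ⟨fun w y => ⟨exists_tauCycle_of_isShareshianPair, ?_⟩, ?_, ?_, ?_⟩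
  · rintro ⟨Δ, hΔ, rfl, hanti⟩
    exact isShareshianPair_of_isDecorated ⟨hΔ, hanti⟩
  · exact fun p hp => isShareshianPair_of_isDecorated hp
  · rintro ⟨w, Δ⟩ h ⟨w', Δ'⟩ h' heq
    obtain ⟨rfl, hτ⟩ := Prod.mk.inj heq
    exact Prod.ext rfl
      (tauCycle_injOn (Fin.last m) h.1 h'.1 (mul_right_cancel (mul_right_cancel hτ)))
  · rintro ⟨w, y⟩ h
    obtain ⟨Δ, hΔ, hy, hanti⟩ := exists_tauCycle_of_isShareshianPair h
    exact ⟨(w, Δ), ⟨hΔ, hanti⟩, Prod.ext rfl hy.symm⟩
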